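/- Let $\mathcal M=\langle \mathcal S,\mathcal A,\mathsf P,r,\gamma\rangle$ be a Markov decision process with finite nonempty state space $\mathcal S$ and action space $\mathcal A$, transition probabilities $\mathsf P(\cdot\mid s,a)$, per-step reward $r:\mathcal S\times\mathcal A\to\mathbb R$ and discount factor $\gamma\in(0,1)$. For a (randomized) Markov strategy $\pi$, which assigns to each state a probability distribution on $\mathcal A$, let $$V_\pi(s)=(1-\gamma)\,\mathbb E_\pi\Bigl[\sum_{t=0}^\infty\gamma^t r(S_t,A_t)\Bigm|S_0=s\Bigr].$$ A strategy $\pi$ is optimal if $V_\pi(s)\ge V_{\tilde\pi}(s)$, and $\alpha$-optimal if $V_\pi(s)\ge V_{\tilde\pi}(s)-\alpha$, for all states $s$ and all Markov strategies $\tilde\pi$. Write $\operatorname{span}(r)=\max_{s,a} r(s,a)-\min_{s,a} r(s,a)$. Let $\alpha>0$ and $p>0$, and let $n\ge 1$ be an integer with $$n\ \ge\ \Bigl\lceil\Bigl(\frac{\gamma}{1-\gamma}\operatorname{span}(r)\Bigr)^2\,\frac{2\log(2|\mathcal S||\mathcal A|/p)}{\alpha^2}\Bigr\rceil .$$ For each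 state-action pair $(s,a)$ draw $n$ samples from $\mathsf P(\cdot\mid s,a)$, all $n|\mathcal S||\mathcal A|$ samples being independent. Let $\widehat{\mathsf P}_n(s'\mid s,a)$ be the fraction of the $n$ samples for $(s,a)$ that equal $s'$, and let $\widehat{\mathcal M}_n=\langle \mathcal S,\mathcal A,\widehat{\mathsf P}_n,r,\gamma\rangle$. Then, with probability at least $1-p$, $\widehat{\mathcal M}_n$ has an optimal strategy and every optimal strategy of $\widehat{\mathcal M}_n$ is $\alpha$-optimal for $\mathcal M$. -/

import Mathlib

open MeasureTheory ProbabilityTheory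

/-- The span seminorm `sup f - inf f` of a function (used here on finite sets, where the supremum
and the infimum are a maximum and a minimum). -/
noncomputable def spanSeminorm {X : Type*} (f : X → ℝ) : ℝ :=
  (⨆ x, f x) - ⨅ x, f x

/-- A discounted Markov decision process with state space `S` and action space `A`. -/
structure MDP (S A : Type*) where
  /-- Controlled transition probabilities: `P s a` is the law of the next state. -/
  P : S → A → PMF S
  /-- Per-step reward. -/
  r : S → A → ℝ
  /-- Discount factor. -/
  γ : ℝ
  γ_pos : 0 < γ
  γ_lt_one : γ < 1

namespace MDP

variable {S A : Type*}

/-- A (randomized, time-homogeneous) Markov strategy: `π s` is the law of the action at state `s`. -/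
abbrev Strategy (S A : Type*) : Type _ := S → PMF A

/-- The law of `(s, a)` when `a` is drawn from `π s`. -/
noncomputable def attachAction (π : Strategy S A) (s : S) : PMF (S × A) :=
  (π s).map fun a => (s, a)

/-- One step of the controlled process under `π`: given the current state-action pair `(s, a)`,
the next state `s'` is drawn from `P s a`, and then the next action from `π s'`. -/
noncomputable def stepLaw (M : MDP S A) (π : Strategy S A) (x : S × A) : PMF (S × A) :=
  (M.P x.1 x.2).bind (attachAction π)

section Trajectory

variable [Finite S] [MeasurableSpace S] [DiscreteMeasurableSpace S]
  [Finite A] [MeasurableSpace A] [DiscreteMeasurableSpace A]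

/-- The transition kernel of the state-action process under `π`, as a kernel from the history up
to time `t` to the state-action pair at time `t + 1`; it depends on the last pair only. -/
noncomputable def stepKernel (M : MDP S A) (π : Strategy S A) (t : ℕ) :
    Kernel ((_i : Finset.Iic t) → S × A) (S × A) :=
  (Kernel.ofFunOfCountable fun x => (M.stepLaw π x).toMeasure).comap
    (fun h => h ⟨t, Finset.mem_Iic.2 le_rfl⟩) (measurable_pi_apply _)

instance (M : MDP S A) (π : Strategy S A) (t : ℕ) : IsMarkovKernel (M.stepKernel π t) where
  isProbabilityMeasure _ := PMF.toMeasure.isProbabilityMeasure _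

/-- The joint law of the trajectory `(S_t, A_t)`, `t ≥ 0`, under `π` with `S_0 = s`. -/
noncomputable def trajectoryLaw (M : MDP S A) (π : Strategy S A) (s : S) : Measure (ℕ → S × A) :=
  Kernel.trajMeasure (X := fun _ => S × A) (attachAction π s).toMeasure (M.stepKernel π)

/-- The (normalized) expected discounted total reward of `π` started at `s`. -/
noncomputable def value (M : MDP S A) (π : Strategy S A) (s : S) : ℝ :=
  (1 - M.γ) * ∫ x, ∑' t : ℕ, M.γ ^ t * M.r (x t).1 (x t).2 ∂(M.trajectoryLaw π s)

/-- `π` is optimal: it does at least as well as every Markov strategy from every state. -/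
def IsOptimal (M : MDP S A) (π : Strategy S A) : Prop :=
  ∀ (π' : Strategy S A) (s : S), M.value π' s ≤ M.value π s

/-- `π` is `α`-optimal. -/
def IsApproxOptimal (M : MDP S A) (α : ℝ) (π : Strategy S A) : Prop :=
  ∀ (π' : Strategy S A) (s : S), M.value π' s - α ≤ M.value π s

end Trajectory

section Empirical

variable [Fintype S] [DecidableEq S]

/-- The number of occurrences of `s'` among the samples `x`. -/
def count {n : ℕ} (x : Fin n → S) (s' : S) : ℕ :=
  (Finset.univ.filter fun k => x k = s').card

/-- The empirical distribution `s' ↦ count s' / n` of `n ≥ 1` samples. -/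
noncomputable def empiricalPMF {n : ℕ} [NeZero n] (x : Fin n → S) : PMF S :=
  PMF.ofFintype (fun s' => (count x s' : ENNReal) / (n : ENNReal)) (by
    have h : ∑ s', count x s' = n := by
      simpa [count] using
        (Finset.card_eq_sum_card_fiberwise (s := Finset.univ) (t := Finset.univ) (f := x)
          (fun _ _ => Finset.mem_univ _)).symm
    simp only [div_eq_mul_inv]
    rw [← Finset.sum_mul, ← Nat.cast_sum, h]
    exact ENNReal.mul_inv_cancel (by exact_mod_cast NeZero.ne n) (ENNReal.natCast_ne_top n))

/-- The empirical MDP: the transition law at `(s, a)` is replaced by the empirical distribution of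
the samples `x (s, a, ·)`; everything else is kept. -/
noncomputable def empirical (M : MDP S A) {n : ℕ} [NeZero n] (x : S × A × Fin n → S) : MDP S A :=
  { M with P := fun s a => empiricalPMF fun k => x (s, a, k) }

end Empirical

end MDP

/-! Two one-sided accuracy statements suffice. If no empirical law underestimates the mean of the
true optimal value `V` by more than `ε`, then `V` is a `γε`-subsolution of the empirical optimality
equation. If no empirical law overestimates the mean of the empirical optimal value `W` by more than
`ε` at actions optimal there, then `W` is a `γε`-subsolution of the true Bellman equation of any
empirically optimal strategy. Each costs `γε/(1-γ)` by a comparison principle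
(`IsOptimal.isApproxOptimal_of_mean_le`).

`V` is deterministic, so the first statement is Hoeffding's inequality. `W` depends on the samples.
For a pair `(s, a)` it is replaced by a pinned value, computed with action `a`, the true law and a
bonus `ε` at `s`, which ignores all samples at `s`. A large overestimate on `W` at an optimal action
forces one on the pinned value (`pinnedValue_le_and_lt_mean`), where Hoeffding applies by
independence. A union bound over `2|S||A|` events concludes. -/

namespace PMF

/-! ### Expectations on finite types. -/

variable {X Y : Type*} [Fintype X] [Fintype Y]

/-- The expectation of a real function under a probability mass function on a finite type. -/
noncomputable def mean (p : PMF X) (f : X → ℝ) : ℝ := ∑ x, (p x).toReal * f x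

theorem sum_toReal (p : PMF X) : ∑ x, (p x).toReal = 1 := by
  rw [← ENNReal.toReal_sum fun x _ => p.apply_ne_top x, ← tsum_fintype (L := .unconditional X),
    p.tsum_coe, ENNReal.toReal_one]

theorem mean_mono (p : PMF X) {f g : X → ℝ} (h : ∀ x, f x ≤ g x) : p.mean f ≤ p.mean g :=
  Finset.sum_le_sum fun x _ => mul_le_mul_of_nonneg_left (h x) ENNReal.toReal_nonneg

theorem mean_const (p : PMF X) (c : ℝ) : p.mean (fun _ => c) = c := by
  simp [mean, ← Finset.sum_mul, sum_toReal]

theorem mean_add (p : PMF X) (f g : X → ℝ) :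
    p.mean (fun x => f x + g x) = p.mean f + p.mean g := by
  simp [mean, mul_add, Finset.sum_add_distrib]

theorem mean_sub (p : PMF X) (f g : X → ℝ) :
    p.mean (fun x => f x - g x) = p.mean f - p.mean g := by
  simp [mean, mul_sub, Finset.sum_sub_distrib]

theorem mean_const_mul (p : PMF X) (c : ℝ) (f : X → ℝ) :
    p.mean (fun x => c * f x) = c * p.mean f := by
  simp only [mean, Finset.mul_sum]
  exact Finset.sum_congr rfl fun x _ => by ring

theorem mean_add_const (p : PMF X) (f : X → ℝ) (c : ℝ) :
    p.mean (fun x => f x + c) = p.mean f + c := by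
  rw [mean_add, mean_const]

theorem mean_le_of_le (p : PMF X) {f : X → ℝ} {c : ℝ} (h : ∀ x, f x ≤ c) : p.mean f ≤ c :=
  (p.mean_mono h).trans_eq (p.mean_const c)

theorem integral_toMeasure_eq_mean [MeasurableSpace X] [MeasurableSingletonClass X] (p : PMF X)
    (f : X → ℝ) : ∫ x, f x ∂p.toMeasure = p.mean f := by
  simp [integral_eq_sum, mean]

theorem mean_pure (x : X) (f : X → ℝ) : (PMF.pure x).mean f = f x := by
  classical
  rw [mean, Finset.sum_eq_single x]
  · simp
  · intro y _ hy
    simp [PMF.pure_apply, hy]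
  · simp

theorem mean_bind (p : PMF X) (q : X → PMF Y) (f : Y → ℝ) :
    (p.bind q).mean f = p.mean fun x => (q x).mean f := by
  simp only [mean, PMF.bind_apply, tsum_fintype, Finset.mul_sum]
  rw [Finset.sum_comm]
  refine Finset.sum_congr rfl fun y _ => ?_
  rw [ENNReal.toReal_sum fun x _ => ENNReal.mul_ne_top (p.apply_ne_top x) ((q x).apply_ne_top y),
    Finset.sum_mul]
  exact Finset.sum_congr rfl fun x _ => by rw [ENNReal.toReal_mul, mul_assoc]

theorem mean_map (p : PMF X) (g : X → Y) (f : Y → ℝ) :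
    (p.map g).mean f = p.mean fun x => f (g x) := by
  rw [← PMF.bind_pure_comp, mean_bind]
  simp [mean_pure]

theorem hasSum_mean (p : PMF X) {F : ℕ → X → ℝ} {f : X → ℝ}
    (h : ∀ x, HasSum (fun t => F t x) (f x)) : HasSum (fun t => p.mean (F t)) (p.mean f) :=
  hasSum_sum fun x _ => (h x).mul_left _

/-- If `f ≤ c` and the mean of `f` is `c`, then `f = c` on the support. -/
theorem eq_of_mean_eq (p : PMF X) {f : X → ℝ} {c : ℝ} (hf : ∀ x, f x ≤ c) (hc : p.mean f = c)
    {x : X} (hx : p x ≠ 0) : f x = c := by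
  have h0 : p.mean (fun x => c - f x) = 0 := by rw [mean_sub, mean_const, hc, sub_self]
  have h1 := (Finset.sum_eq_zero_iff_of_nonneg fun x _ =>
    mul_nonneg ENNReal.toReal_nonneg (sub_nonneg.2 (hf x))).1 h0 x (Finset.mem_univ x)
  rcases mul_eq_zero.1 h1 with h | h
  · exact absurd h (ENNReal.toReal_pos hx (p.apply_ne_top x)).ne'
  · linarith

end PMF

/-! ### Comparison principle for discounted operators. -/

/-- A monotone operator on functions that discounts the addition of nonnegative constants. -/
structure IsDiscounted {S : Type*} (γ : ℝ) (F : (S → ℝ) → S → ℝ) : Prop where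
  mono : Monotone F
  add_const_le : ∀ (V : S → ℝ) (c : ℝ), 0 ≤ c → ∀ s, F (fun s => V s + c) s ≤ F V s + γ * c

namespace IsDiscounted

variable {S : Type*} {γ : ℝ} {F : (S → ℝ) → S → ℝ}

/-- A `δ`-subsolution lies below every supersolution up to `δ / (1 - γ)`. -/
theorem le_add_div [Finite S] (hF : IsDiscounted γ F) (hγ : γ < 1) {V W : S → ℝ} {δ : ℝ}
    (hδ : 0 ≤ δ) (hV : ∀ s, V s ≤ F V s + δ) (hW : ∀ s, F W s ≤ W s) (s : S) :
    V s ≤ W s + δ / (1 - γ) := by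
  have : Nonempty S := ⟨s⟩
  obtain ⟨m, hm⟩ := Finite.exists_max fun s => V s - W s
  have h1 : 0 < 1 - γ := by linarith
  have hs := hm s
  suffices V m - W m ≤ δ / (1 - γ) by linarith
  -- Only a positive maximum `c` of `V - W` may be used as the added constant; discounting then
  -- gives `c ≤ γ c + δ`.
  rcases le_or_gt (V m - W m) 0 with h0 | h0
  · exact h0.trans (div_nonneg hδ h1.le)
  · have h2 : V ≤ fun s => W s + (V m - W m) := fun s => by linarith [hm s]
    have h3 := hF.mono h2 m
    have h4 := hF.add_const_le W _ h0.le m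
    rw [le_div_iff₀ h1]
    linarith [hV m, hW m]

theorem le_of_le [Finite S] (hF : IsDiscounted γ F) (hγ : γ < 1) {V W : S → ℝ}
    (hV : ∀ s, V s ≤ F V s) (hW : ∀ s, F W s ≤ W s) (s : S) : V s ≤ W s := by
  simpa using hF.le_add_div hγ le_rfl (fun s => by simpa using hV s) hW s

theorem exists_fixedPoint [Fintype S] (hF : IsDiscounted γ F) (h0 : 0 ≤ γ) (h1 : γ < 1) :
    ∃ V : S → ℝ, F V = V := by
  have hle (V W : S → ℝ) (s : S) : F V s ≤ F W s + γ * dist V W := by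
    have h : V ≤ fun s => W s + dist V W := fun s => by
      have := (abs_le.1 ((Real.dist_eq _ _).symm.le.trans (dist_le_pi_dist V W s))).2
      linarith
    exact (hF.mono h s).trans (hF.add_const_le W _ dist_nonneg s)
  have hc : ContractingWith ⟨γ, h0⟩ F := by
    refine ⟨by exact_mod_cast h1, LipschitzWith.of_dist_le_mul fun V W => ?_⟩
    refine (dist_pi_le_iff (by positivity)).2 fun s => ?_
    have h2 := hle V W s
    have h3 := hle W V s
    rw [dist_comm W V] at h3
    rw [Real.dist_eq, abs_le]
    change -(γ * dist V W) ≤ _ ∧ _ ≤ γ * dist V W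
    constructor <;> linarith
  exact ⟨_, hc.fixedPoint_isFixedPt⟩

/-- Both properties are checked coordinate by coordinate. This covers the optimality operator with
its rule at one state replaced. -/
theorem update [DecidableEq S] (hF : IsDiscounted γ F) (s : S) {g : (S → ℝ) → ℝ}
    (hg : Monotone g) (hg' : ∀ V c, 0 ≤ c → g (fun s => V s + c) ≤ g V + γ * c) :
    IsDiscounted γ fun V => Function.update (F V) s (g V) where
  mono V W h t := by
    by_cases ht : t = s
    · subst ht; simpa using hg h
    · simpa [ht] using hF.mono h t
  add_const_le V c hc t := by
    by_cases ht : t = s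
    · subst ht; simpa using hg' V c hc
    · simpa [ht] using hF.add_const_le V c hc t

end IsDiscounted

/-! ### Bellman operators. -/

namespace MDP

variable {S A : Type*} [Fintype S] (M : MDP S A)

/-- The normalized state-action value of one step followed by the continuation value `V`. -/
noncomputable def lookahead (V : S → ℝ) (s : S) (a : A) : ℝ :=
  (1 - M.γ) * M.r s a + M.γ * (M.P s a).mean V

theorem lookahead_mono {V W : S → ℝ} (h : V ≤ W) (s : S) (a : A) :
    M.lookahead V s a ≤ M.lookahead W s a :=
  add_le_add_right (mul_le_mul_of_nonneg_left ((M.P s a).mean_mono h) M.γ_pos.le) _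

theorem lookahead_add_const (V : S → ℝ) (c : ℝ) (s : S) (a : A) :
    M.lookahead (fun s => V s + c) s a = M.lookahead V s a + M.γ * c := by
  simp only [lookahead, PMF.mean_add_const]; ring

variable [Fintype A]

/-- The Bellman operator of a strategy. -/
noncomputable def policyOperator (π : Strategy S A) (V : S → ℝ) (s : S) : ℝ :=
  (π s).mean (M.lookahead V s)

/-- The Bellman optimality operator. -/
noncomputable def optimalityOperator (V : S → ℝ) (s : S) : ℝ :=
  ⨆ a, M.lookahead V s a

theorem lookahead_le_optimalityOperator (V : S → ℝ) (s : S) (a : A) :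
    M.lookahead V s a ≤ M.optimalityOperator V s :=
  le_ciSup (Set.finite_range _).bddAbove a

theorem policyOperator_isDiscounted (π : Strategy S A) :
    IsDiscounted M.γ (M.policyOperator π) where
  mono _ _ h s := (π s).mean_mono fun a => M.lookahead_mono h s a
  add_const_le V c _ s := by
    have h : M.lookahead (fun s => V s + c) s = fun a => M.lookahead V s a + M.γ * c :=
      funext fun a => M.lookahead_add_const V c s a
    exact (congrArg (π s).mean h).trans ((π s).mean_add_const _ _) |>.le

theorem policyOperator_le_optimalityOperator (π : Strategy S A) (V : S → ℝ) (s : S) :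
    M.policyOperator π V s ≤ M.optimalityOperator V s :=
  (π s).mean_le_of_le fun a => M.lookahead_le_optimalityOperator V s a

theorem optimalityOperator_isDiscounted [Nonempty A] :
    IsDiscounted M.γ M.optimalityOperator where
  mono V W h s := ciSup_le fun a =>
    (M.lookahead_mono h s a).trans (M.lookahead_le_optimalityOperator W s a)
  add_const_le V c _ s := ciSup_le fun a => by
    rw [lookahead_add_const]
    exact add_le_add_left (M.lookahead_le_optimalityOperator V s a) _

theorem exists_lookahead_eq_optimalityOperator [Nonempty A] (V : S → ℝ) (s : S) :
    ∃ a, M.lookahead V s a = M.optimalityOperator V s :=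
  exists_eq_ciSup_of_finite

/-! ### The Bellman equation from the trajectory law. -/

section Value

variable (π : Strategy S A)

/-- The expectation of `f` after one step of the state-action process. -/
noncomputable def stepMean (f : S × A → ℝ) (x : S × A) : ℝ := (M.stepLaw π x).mean f

theorem abs_iterate_stepMean_le {f : S × A → ℝ} {C : ℝ} (hf : ∀ x, |f x| ≤ C) (t : ℕ) :
    ∀ x, |(M.stepMean π)^[t] f x| ≤ C := by
  induction t generalizing f with
  | zero => exact hf
  | succ t ih =>
    rw [Function.iterate_succ_apply]
    refine ih fun x => abs_le.2 ⟨?_, ?_⟩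
    · exact ((M.stepLaw π x).mean_const _).symm.trans_le
        (PMF.mean_mono _ fun y => (abs_le.1 (hf y)).1)
    · exact PMF.mean_le_of_le _ fun y => (abs_le.1 (hf y)).2

/-- The unnormalized state-action value of a strategy. -/
noncomputable def stateActionValue (x : S × A) : ℝ :=
  ∑' t : ℕ, M.γ ^ t * (M.stepMean π)^[t] (fun y => M.r y.1 y.2) x

theorem exists_abs_reward_le : ∃ C, ∀ x : S × A, |M.r x.1 x.2| ≤ C := by
  obtain ⟨C, hC⟩ := (Set.finite_range fun x : S × A => |M.r x.1 x.2|).bddAbove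
  exact ⟨C, fun x => hC ⟨x, rfl⟩⟩

theorem hasSum_stateActionValue (x : S × A) :
    HasSum (fun t : ℕ => M.γ ^ t * (M.stepMean π)^[t] (fun y => M.r y.1 y.2) x)
      (M.stateActionValue π x) := by
  obtain ⟨C, hC⟩ := M.exists_abs_reward_le
  refine (Summable.of_norm_bounded
    ((summable_geometric_of_lt_one M.γ_pos.le M.γ_lt_one).mul_right C) fun t => ?_).hasSum
  rw [Real.norm_eq_abs, abs_mul, abs_of_nonneg (pow_nonneg M.γ_pos.le t)]
  exact mul_le_mul_of_nonneg_left (M.abs_iterate_stepMean_le π hC t x) (pow_nonneg M.γ_pos.le t)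

theorem stateActionValue_eq (x : S × A) :
    M.stateActionValue π x = M.r x.1 x.2 + M.γ * M.stepMean π (M.stateActionValue π) x := by
  rw [stateActionValue, (M.hasSum_stateActionValue π x).summable.tsum_eq_zero_add]
  congr 1
  · simp
  · refine HasSum.tsum_eq ?_
    have h (t : ℕ) : M.γ * (M.stepLaw π x).mean
          (fun y => M.γ ^ t * (M.stepMean π)^[t] (fun y => M.r y.1 y.2) y) =
        M.γ ^ (t + 1) * (M.stepMean π)^[t + 1] (fun y => M.r y.1 y.2) x := by
      rw [Function.iterate_succ_apply', PMF.mean_const_mul, pow_succ', mul_assoc]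
      rfl
    have h' := ((M.stepLaw π x).hasSum_mean
      (F := fun t y => M.γ ^ t * (M.stepMean π)^[t] (fun y => M.r y.1 y.2) y)
      (M.hasSum_stateActionValue π)).mul_left M.γ
    simp only [h] at h'
    exact h'

variable [MeasurableSpace S] [DiscreteMeasurableSpace S]
  [MeasurableSpace A] [DiscreteMeasurableSpace A]

instance (s : S) : IsProbabilityMeasure (M.trajectoryLaw π s) := by
  have := PMF.toMeasure.isProbabilityMeasure (attachAction π s)
  unfold trajectoryLaw
  infer_instance

theorem map_eval_zero_trajectoryLaw (s : S) :
    (M.trajectoryLaw π s).map (fun x => x 0) = (attachAction π s).toMeasure := by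
  have h : (fun x : ℕ → S × A => x 0) =
      (MeasurableEquiv.piUnique fun _ : Finset.Iic 0 => S × A) ∘ Preorder.frestrictLe 0 := rfl
  rw [h, ← Measure.map_map (by fun_prop) (by fun_prop), trajectoryLaw, Kernel.trajMeasure,
    Measure.map_comp _ _ (by fun_prop), Kernel.traj_map_frestrictLe, Kernel.partialTraj_self,
    Measure.id_comp, Measure.map_map (by fun_prop) (by fun_prop)]
  exact Measure.map_id

theorem integral_eval_zero (s : S) (f : S × A → ℝ) :
    ∫ x, f (x 0) ∂M.trajectoryLaw π s = (attachAction π s).mean f := by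
  rw [← PMF.integral_toMeasure_eq_mean, ← M.map_eval_zero_trajectoryLaw π s,
    integral_map (measurable_pi_apply 0).aemeasurable
      (Measurable.aestronglyMeasurable (by fun_prop))]

theorem integrable_eval (s : S) (t : ℕ) (f : S × A → ℝ) :
    Integrable (fun x => f (x t)) (M.trajectoryLaw π s) := by
  obtain ⟨C, hC⟩ := (Set.finite_range fun y => ‖f y‖).bddAbove
  exact Integrable.of_bound (Measurable.aestronglyMeasurable (by fun_prop)) C
    (ae_of_all _ fun x => hC ⟨x t, rfl⟩)

/-- The Markov property: the history up to `t` and the next pair have as joint law the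
composition-product with `stepKernel`, and the next pair is integrated out. -/
theorem integral_eval_succ (s : S) (t : ℕ) (f : S × A → ℝ) :
    ∫ x, f (x (t + 1)) ∂M.trajectoryLaw π s =
      ∫ x, (M.stepLaw π (x t)).mean f ∂M.trajectoryLaw π s := by
  have := PMF.toMeasure.isProbabilityMeasure (attachAction π s)
  have key := Kernel.map_frestrictLe_trajMeasure_compProd_eq_map_trajMeasure
    (X := fun _ => S × A) (μ₀ := (attachAction π s).toMeasure) (κ := M.stepKernel π) (a := t)
  change (M.trajectoryLaw π s).map _ ⊗ₘ _ = (M.trajectoryLaw π s).map _ at key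
  have hint : Integrable (fun z : ((_i : Finset.Iic t) → S × A) × (S × A) => f z.2)
      ((M.trajectoryLaw π s).map (Preorder.frestrictLe t) ⊗ₘ M.stepKernel π t) := by
    rw [key, integrable_map_measure (Measurable.aestronglyMeasurable (by fun_prop))
      (by fun_prop)]
    exact M.integrable_eval π s (t + 1) f
  have h1 : ∫ x, f (x (t + 1)) ∂M.trajectoryLaw π s =
      ∫ z, f z.2 ∂((M.trajectoryLaw π s).map (Preorder.frestrictLe t) ⊗ₘ M.stepKernel π t) := by
    rw [key, integral_map (by fun_prop) (Measurable.aestronglyMeasurable (by fun_prop))]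
  have h2 (h : (_i : Finset.Iic t) → S × A) : ∫ y, f y ∂M.stepKernel π t h =
      (M.stepLaw π (h ⟨t, Finset.mem_Iic.2 le_rfl⟩)).mean f :=
    PMF.integral_toMeasure_eq_mean _ f
  let g : ((_i : Finset.Iic t) → S × A) → ℝ := fun h =>
    (M.stepLaw π (h ⟨t, Finset.mem_Iic.2 le_rfl⟩)).mean f
  have h3 : Measurable g := by
    have : Measurable fun y => (M.stepLaw π y).mean f := .of_discrete
    exact this.comp (measurable_pi_apply _)
  have h4 : ∫ h, g h ∂(M.trajectoryLaw π s).map (Preorder.frestrictLe t) =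
      ∫ x, g (Preorder.frestrictLe t x) ∂M.trajectoryLaw π s :=
    integral_map (Preorder.measurable_frestrictLe t).aemeasurable h3.aestronglyMeasurable
  rw [h1, Measure.integral_compProd hint]
  simp only [h2]
  exact h4

theorem integral_eval (s : S) (t : ℕ) (f : S × A → ℝ) :
    ∫ x, f (x t) ∂M.trajectoryLaw π s = (attachAction π s).mean ((M.stepMean π)^[t] f) := by
  induction t generalizing f with
  | zero => exact M.integral_eval_zero π s f
  | succ t ih => rw [integral_eval_succ, Function.iterate_succ_apply, ← ih]; rfl

/-- Rewards are bounded, so geometric domination lets sum and integral be exchanged. -/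
theorem value_eq_mean_stateActionValue (s : S) :
    M.value π s = (1 - M.γ) * (attachAction π s).mean (M.stateActionValue π) := by
  rw [value]
  congr 1
  obtain ⟨C, hC⟩ := M.exists_abs_reward_le
  have hint (t : ℕ) : Integrable (fun x : ℕ → S × A => M.γ ^ t * M.r (x t).1 (x t).2)
      (M.trajectoryLaw π s) :=
    (M.integrable_eval π s t fun y => M.r y.1 y.2).const_mul _
  have hsum : Summable fun t : ℕ =>
      ∫ x : ℕ → S × A, ‖M.γ ^ t * M.r (x t).1 (x t).2‖ ∂M.trajectoryLaw π s := by
    refine Summable.of_nonneg_of_le (fun t => integral_nonneg fun _ => norm_nonneg _) (fun t => ?_)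
      ((summable_geometric_of_lt_one M.γ_pos.le M.γ_lt_one).mul_right C)
    have h : ∀ x : ℕ → S × A, ‖M.γ ^ t * M.r (x t).1 (x t).2‖ ≤ M.γ ^ t * C := fun x => by
      rw [Real.norm_eq_abs, abs_mul, abs_of_nonneg (pow_nonneg M.γ_pos.le t)]
      exact mul_le_mul_of_nonneg_left (hC (x t)) (pow_nonneg M.γ_pos.le t)
    simpa using integral_mono (hint t).norm (integrable_const _) h
  have h1 := hasSum_integral_of_summable_integral_norm hint hsum
  refine h1.unique ?_
  have h2 (t : ℕ) : (attachAction π s).mean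
        (fun y => M.γ ^ t * (M.stepMean π)^[t] (fun y => M.r y.1 y.2) y) =
      ∫ x : ℕ → S × A, M.γ ^ t * M.r (x t).1 (x t).2 ∂M.trajectoryLaw π s := by
    rw [integral_const_mul, PMF.mean_const_mul, M.integral_eval π s t fun y => M.r y.1 y.2]
  have h3 := (attachAction π s).hasSum_mean
    (F := fun t y => M.γ ^ t * (M.stepMean π)^[t] (fun y => M.r y.1 y.2) y)
    (M.hasSum_stateActionValue π)
  simp only [h2] at h3
  exact h3

/-- The Bellman equation for the value of a strategy. -/
theorem policyOperator_value : M.policyOperator π (M.value π) = M.value π := by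
  funext s
  rw [value_eq_mean_stateActionValue, attachAction, PMF.mean_map, ← PMF.mean_const_mul]
  refine congrArg (π s).mean (funext fun a => ?_)
  rw [stateActionValue_eq, stepMean, stepLaw, PMF.mean_bind, lookahead]
  simp only [funext fun s => M.value_eq_mean_stateActionValue π s, PMF.mean_const_mul]
  ring

end Value

end MDP

/-! ### Optimal values and optimal strategies. -/

/-- A fixed point of `F`, if there is one. -/
noncomputable def someFixedPoint {S : Type*} (F : (S → ℝ) → S → ℝ) : S → ℝ :=
  Classical.epsilon fun V => F V = V

/-- The choice depends on `F` alone, so equal operators get the same fixed point;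
`pinnedValue_congr` rests on this. -/
theorem IsDiscounted.apply_someFixedPoint {S : Type*} [Fintype S] {γ : ℝ}
    {F : (S → ℝ) → S → ℝ} (hF : IsDiscounted γ F) (h0 : 0 ≤ γ) (h1 : γ < 1) :
    F (someFixedPoint F) = someFixedPoint F :=
  Classical.epsilon_spec (p := fun V => F V = V) (hF.exists_fixedPoint h0 h1)

namespace MDP

variable {S A : Type*} [Fintype S] (M : MDP S A)

/-- The normalization by `1 - γ` makes the lookahead a convex combination. Optimal values thus stay
in the range of `r`, and Hoeffding sees `span r` without a factor `1/(1-γ)`. -/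
theorem lookahead_le_const {V : S → ℝ} {c : ℝ} (hV : ∀ s, V s ≤ c) {s : S} {a : A}
    (hr : M.r s a ≤ c) : M.lookahead V s a ≤ c := by
  have h1 := (M.P s a).mean_le_of_le hV
  have h2 := M.γ_lt_one
  have h3 := M.γ_pos
  rw [lookahead]
  nlinarith

theorem const_le_lookahead {V : S → ℝ} {c : ℝ} (hV : ∀ s, c ≤ V s) {s : S} {a : A}
    (hr : c ≤ M.r s a) : c ≤ M.lookahead V s a := by
  have h1 := ((M.P s a).mean_const c).symm.trans_le ((M.P s a).mean_mono hV)
  have h2 := M.γ_lt_one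
  have h3 := M.γ_pos
  rw [lookahead]
  nlinarith

/-- The optimal value function: the solution of the Bellman optimality equation. -/
noncomputable def optimalValue : S → ℝ := someFixedPoint M.optimalityOperator

section Nonempty

variable [Fintype A] [Nonempty A]

theorem optimalityOperator_optimalValue :
    M.optimalityOperator M.optimalValue = M.optimalValue :=
  M.optimalityOperator_isDiscounted.apply_someFixedPoint M.γ_pos.le M.γ_lt_one

theorem optimalValue_le {c : ℝ} (hr : ∀ s a, M.r s a ≤ c) (s : S) : M.optimalValue s ≤ c :=
  M.optimalityOperator_isDiscounted.le_of_le M.γ_lt_one (W := fun _ => c)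
    (fun s => (congrFun M.optimalityOperator_optimalValue s).ge)
    (fun s => ciSup_le fun a => M.lookahead_le_const (fun _ => le_rfl) (hr s a)) s

theorem le_optimalValue {c : ℝ} (hr : ∀ s a, c ≤ M.r s a) (s : S) : c ≤ M.optimalValue s :=
  M.optimalityOperator_isDiscounted.le_of_le M.γ_lt_one (V := fun _ => c)
    (fun s => (M.const_le_lookahead (fun _ => le_rfl) (hr s (Classical.arbitrary A))).trans
      (M.lookahead_le_optimalityOperator _ s _))
    (fun s => (congrFun M.optimalityOperator_optimalValue s).le) s

section Optimality

variable [MeasurableSpace S] [DiscreteMeasurableSpace S]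
  [MeasurableSpace A] [DiscreteMeasurableSpace A]

theorem value_le_optimalValue (π : Strategy S A) (s : S) : M.value π s ≤ M.optimalValue s :=
  (M.policyOperator_isDiscounted π).le_of_le M.γ_lt_one
    (fun s => (congrFun (M.policyOperator_value π) s).ge)
    (fun s => (M.policyOperator_le_optimalityOperator π _ s).trans
      (congrFun M.optimalityOperator_optimalValue s).le) s

/-- A greedy deterministic strategy attains the optimal value. -/
theorem exists_value_eq_optimalValue : ∃ π : Strategy S A, ∀ s, M.value π s = M.optimalValue s := by
  choose a ha using M.exists_lookahead_eq_optimalityOperator M.optimalValue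
  refine ⟨fun s => PMF.pure (a s), fun s => (M.value_le_optimalValue _ s).antisymm ?_⟩
  refine (M.policyOperator_isDiscounted _).le_of_le M.γ_lt_one (fun s => ?_)
    (fun s => (congrFun (M.policyOperator_value _) s).le) s
  rw [policyOperator, PMF.mean_pure, ha, optimalityOperator_optimalValue]

theorem exists_isOptimal : ∃ π : Strategy S A, M.IsOptimal π := by
  obtain ⟨π, hπ⟩ := M.exists_value_eq_optimalValue
  exact ⟨π, fun π' s => (M.value_le_optimalValue π' s).trans (hπ s).ge⟩

variable {M}

theorem IsOptimal.value_eq {π : Strategy S A} (h : M.IsOptimal π) : M.value π = M.optimalValue := by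
  obtain ⟨π', hπ'⟩ := M.exists_value_eq_optimalValue
  exact funext fun s => (M.value_le_optimalValue π s).antisymm ((hπ' s).ge.trans (h π' s))

/-- The average over `π s` equals the maximum, so only maximizers carry mass. Accuracy from above is
therefore needed only at optimal actions. -/
theorem IsOptimal.lookahead_eq {π : Strategy S A} (h : M.IsOptimal π) {s : S} {a : A}
    (ha : π s a ≠ 0) : M.lookahead M.optimalValue s a = M.optimalValue s := by
  refine (π s).eq_of_mean_eq (fun a => ?_) ?_ ha
  · exact (M.lookahead_le_optimalityOperator _ s a).trans
      (congrFun M.optimalityOperator_optimalValue s).le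
  · have := congrFun (M.policyOperator_value π) s
    rwa [h.value_eq] at this

/-- Plug-in optimality: an optimal strategy of `N` is `2γε/(1-γ)`-optimal for `M` if the transition
laws of `N` are `ε`-accurate from below on the optimal value of `M`, and `ε`-accurate from above on
the optimal value of `N` at the optimal actions of `N`. -/
theorem IsOptimal.isApproxOptimal_of_mean_le {N : MDP S A} (hr : N.r = M.r) (hγ : N.γ = M.γ)
    {ε : ℝ} (hε : 0 ≤ ε)
    (hM : ∀ s a, (M.P s a).mean M.optimalValue ≤ (N.P s a).mean M.optimalValue + ε)
    (hN : ∀ s a, N.lookahead N.optimalValue s a = N.optimalValue s →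
      (N.P s a).mean N.optimalValue ≤ (M.P s a).mean N.optimalValue + ε)
    {π : Strategy S A} (hπ : N.IsOptimal π) :
    M.IsApproxOptimal (2 * (M.γ * ε / (1 - M.γ))) π := by
  have hγε : 0 ≤ M.γ * ε := mul_nonneg M.γ_pos.le hε
  have h1 (s : S) : M.optimalValue s ≤ N.optimalValue s + M.γ * ε / (1 - M.γ) := by
    rw [← hγ]
    refine N.optimalityOperator_isDiscounted.le_add_div N.γ_lt_one (hγ ▸ hγε) (fun s => ?_)
      (fun s => (congrFun N.optimalityOperator_optimalValue s).le) s
    obtain ⟨a, ha⟩ := M.exists_lookahead_eq_optimalityOperator M.optimalValue s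
    rw [optimalityOperator_optimalValue] at ha
    have h2 := N.lookahead_le_optimalityOperator M.optimalValue s a
    have h3 := mul_le_mul_of_nonneg_left (hM s a) M.γ_pos.le
    simp only [lookahead, hr, hγ] at ha h2 ⊢
    linarith
  have h2 (s : S) : N.optimalValue s ≤ M.value π s + M.γ * ε / (1 - M.γ) := by
    refine (M.policyOperator_isDiscounted π).le_add_div M.γ_lt_one hγε (fun s => ?_)
      (fun s => (congrFun (M.policyOperator_value π) s).le) s
    rw [policyOperator, ← PMF.mean_add_const, ← (π s).mean_const (N.optimalValue s)]
    refine Finset.sum_le_sum fun a _ => ?_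
    -- Nothing is known about the accuracy at unused actions, but their weight is zero.
    by_cases ha : π s a = 0
    · simp [ha]
    · refine mul_le_mul_of_nonneg_left ?_ ENNReal.toReal_nonneg
      have h3 := hπ.lookahead_eq ha
      have h4 := mul_le_mul_of_nonneg_left (hN s a h3) M.γ_pos.le
      simp only [lookahead, hr, hγ] at h3 ⊢
      linarith
  intro π' s
  linarith [M.value_le_optimalValue π' s, h1 s, h2 s]

/-- If all rewards agree, then every strategy is optimal up to any `α ≥ 0`. -/
theorem isApproxOptimal_of_reward_eq {α c : ℝ} (hα : 0 ≤ α) (hr : ∀ s a, M.r s a = c)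
    (π : Strategy S A) : M.IsApproxOptimal α π := by
  intro π' s
  have h1 := (M.value_le_optimalValue π' s).trans (M.optimalValue_le (fun s a => (hr s a).le) s)
  have h2 : c ≤ M.value π s :=
    (M.policyOperator_isDiscounted π).le_of_le M.γ_lt_one (V := fun _ => c)
      (fun s => ((π s).mean_const c).symm.trans_le ((π s).mean_mono fun a =>
        M.const_le_lookahead (fun _ => le_rfl) (hr s a).ge))
      (fun s => (congrFun (M.policyOperator_value π) s).le) s
  linarith

end Optimality

end Nonempty

/-! ### Removing the dependence on the samples at one state. -/

section Pinned

variable [DecidableEq S] (s : S) (a : A) (q : PMF S) (ε : ℝ)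

/-- The Bellman optimality operator, modified at the single state `s`: there the action is `a`, the
next state has law `q`, and the continuation value gets a bonus `ε`. -/
noncomputable def pinnedOperator (V : S → ℝ) : S → ℝ :=
  Function.update (M.optimalityOperator V) s ((1 - M.γ) * M.r s a + M.γ * (q.mean V + ε))

/-- The fixed point of the modified optimality operator. It does not depend on the transition laws
of `M` at `s`. -/
noncomputable def pinnedValue : S → ℝ := someFixedPoint (M.pinnedOperator s a q ε)

theorem pinnedValue_congr {N : MDP S A} (hr : N.r = M.r) (hγ : N.γ = M.γ)
    (hP : ∀ t ≠ s, N.P t = M.P t) : N.pinnedValue s a q ε = M.pinnedValue s a q ε := by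
  have : N.pinnedOperator s a q ε = M.pinnedOperator s a q ε := by
    funext V t
    by_cases ht : t = s
    · subst ht; simp [pinnedOperator, hr, hγ]
    · simp [pinnedOperator, ht, optimalityOperator, lookahead, hr, hγ, hP t ht]
  rw [pinnedValue, this, pinnedValue]

variable [Fintype A] [Nonempty A]

theorem pinnedOperator_isDiscounted : IsDiscounted M.γ (M.pinnedOperator s a q ε) := by
  refine M.optimalityOperator_isDiscounted.update s (fun V W h => ?_) fun V c _ => ?_
  · have := mul_le_mul_of_nonneg_left (q.mean_mono h) M.γ_pos.le
    simp only [mul_add]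
    linarith
  · rw [PMF.mean_add_const]
    linarith

theorem pinnedOperator_pinnedValue :
    M.pinnedOperator s a q ε (M.pinnedValue s a q ε) = M.pinnedValue s a q ε :=
  (M.pinnedOperator_isDiscounted s a q ε).apply_someFixedPoint M.γ_pos.le M.γ_lt_one

/-- A constant below the rewards is a subsolution, since the bonus only helps. The bonus may spoil
the matching upper bound. -/
theorem le_pinnedValue {c : ℝ} (hr : ∀ s a, c ≤ M.r s a) (hε : 0 ≤ ε) (t : S) :
    c ≤ M.pinnedValue s a q ε t := by
  refine (M.pinnedOperator_isDiscounted s a q ε).le_of_le M.γ_lt_one (V := fun _ => c)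
    (fun t => ?_) (fun t => (congrFun (M.pinnedOperator_pinnedValue s a q ε) t).le) t
  by_cases ht : t = s
  · subst ht
    have h1 := M.γ_lt_one
    have h2 := mul_nonneg M.γ_pos.le hε
    have h3 := mul_le_mul_of_nonneg_left (hr t a) (sub_nonneg.2 h1.le)
    simp only [pinnedOperator, Function.update_self, PMF.mean_const]
    linarith
  · simp only [pinnedOperator, Function.update_of_ne ht]
    exact (M.const_le_lookahead (fun _ => le_rfl) (hr t (Classical.arbitrary A))).trans
      (M.lookahead_le_optimalityOperator _ t _)

variable {s a q ε}

/-- If an optimal action `a` at `s` is overestimated by more than `ε` on the optimal value, then it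
is overestimated by more than `ε` on the pinned value, which is below the optimal value. -/
theorem pinnedValue_le_and_lt_mean (ha : M.lookahead M.optimalValue s a = M.optimalValue s)
    (h : q.mean M.optimalValue + ε < (M.P s a).mean M.optimalValue) :
    (∀ t, M.pinnedValue s a q ε t ≤ M.optimalValue t) ∧
      q.mean (M.pinnedValue s a q ε) + ε < (M.P s a).mean (M.pinnedValue s a q ε) := by
  have hγ := M.γ_pos
  have hle : ∀ t, M.pinnedValue s a q ε t ≤ M.optimalValue t := by
    refine (M.pinnedOperator_isDiscounted s a q ε).le_of_le M.γ_lt_one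
      (fun t => (congrFun (M.pinnedOperator_pinnedValue s a q ε) t).ge) fun t => ?_
    by_cases ht : t = s
    · subst ht
      have := mul_le_mul_of_nonneg_left h.le hγ.le
      rw [lookahead] at ha
      simp only [pinnedOperator, Function.update_self]
      linarith
    · simp only [pinnedOperator, Function.update_of_ne ht, optimalityOperator_optimalValue, le_refl]
  refine ⟨hle, ?_⟩
  -- Otherwise the pinned value is a supersolution of the operator that forces `a` at `s`. The
  -- optimal value is a fixed point of that operator as `a` is optimal, so the two values coincide,
  -- contradicting `h`.
  by_contra! hcon
  have hge : ∀ t, M.optimalValue t ≤ M.pinnedValue s a q ε t := by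
    have hF : IsDiscounted M.γ fun V =>
        Function.update (M.optimalityOperator V) s (M.lookahead V s a) :=
      M.optimalityOperator_isDiscounted.update s (fun V W h => M.lookahead_mono h s a)
        fun V c _ => (M.lookahead_add_const V c s a).le
    refine hF.le_of_le M.γ_lt_one (fun t => ?_) fun t => ?_
    · by_cases ht : t = s
      · subst ht; simp [ha]
      · simp [ht, optimalityOperator_optimalValue]
    · have hfix := congrFun (M.pinnedOperator_pinnedValue s a q ε) t
      by_cases ht : t = s
      · subst ht
        have := mul_le_mul_of_nonneg_left hcon hγ.le
        simp only [pinnedOperator, Function.update_self] at hfix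
        simp only [Function.update_self, lookahead]
        linarith
      · simp only [pinnedOperator, Function.update_of_ne ht] at hfix ⊢
        exact hfix.le
  rw [show M.pinnedValue s a q ε = M.optimalValue from
    funext fun t => (hle t).antisymm (hge t)] at hcon
  linarith

end Pinned

end MDP

/-! ### Hoeffding bounds. -/

section Concentration

variable {S Ω : Type*} [Fintype S] [MeasurableSpace S] [DiscreteMeasurableSpace S]
  [MeasurableSpace Ω] {μ : Measure Ω} [IsProbabilityMeasure μ] {n : ℕ} [NeZero n]
  {Y : Fin n → Ω → S} {q : PMF S} {lo hi ε : ℝ}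

/-- Hoeffding's inequality for the average of a function of i.i.d. samples from `q`. -/
theorem measureReal_mean_add_lt_average_le (hYmeas : ∀ k, Measurable (Y k))
    (hYlaw : ∀ k, μ.map (Y k) = q.toMeasure) (hYindep : iIndepFun Y μ)
    (hlt : lo < hi) (hε : 0 ≤ ε) {f : S → ℝ} (hlo : ∀ s, lo ≤ f s) (hhi : ∀ s, f s ≤ hi) :
    μ.real {ω | q.mean f + ε < (∑ k, f (Y k ω)) / n} ≤
      Real.exp (-(2 * n * ε ^ 2 / (hi - lo) ^ 2)) := by
  have hn : (0 : ℝ) < n := Nat.cast_pos.2 (NeZero.pos n)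
  have hf : Measurable f := .of_discrete
  have hmean (k : Fin n) : ∫ ω, f (Y k ω) ∂μ = q.mean f := by
    rw [← PMF.integral_toMeasure_eq_mean, ← hYlaw k,
      integral_map (hYmeas k).aemeasurable hf.aestronglyMeasurable]
  have hsub (k : Fin n) :
      HasSubgaussianMGF (fun ω => f (Y k ω) - q.mean f) ((‖hi - lo‖₊ / 2) ^ 2) μ := by
    have := hasSubgaussianMGF_of_mem_Icc (μ := μ) (X := fun ω => f (Y k ω)) (a := lo) (b := hi)
      (hf.comp (hYmeas k)).aemeasurable (ae_of_all _ fun ω => ⟨hlo _, hhi _⟩)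
    rwa [hmean] at this
  have hind : iIndepFun (fun k ω => f (Y k ω) - q.mean f) μ :=
    hYindep.comp (fun _ y => f y - q.mean f) fun _ => .of_discrete
  -- Deviation `nε` of the sum against total variance proxy `n (hi - lo)² / 4`.
  have key := HasSubgaussianMGF.measure_sum_ge_le_of_iIndepFun hind (s := Finset.univ)
    (fun k _ => hsub k) (ε := n * ε) (by positivity)
  refine (measureReal_mono fun ω hω => ?_).trans (key.trans_eq ?_)
  · simp only [Set.mem_ofPred_eq, lt_div_iff₀ hn] at hω
    simp only [Set.mem_ofPred_eq, Finset.sum_sub_distrib, Finset.sum_const, Finset.card_univ,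
      Fintype.card_fin, nsmul_eq_mul]
    linarith
  · have hD : 0 < hi - lo := by linarith
    congr 1
    simp only [Finset.sum_const, Finset.card_univ, Fintype.card_fin, nsmul_eq_mul]
    push_cast
    rw [Real.norm_of_nonneg hD.le]
    field_simp

/-- Hoeffding's inequality for a random function that is independent of the samples. -/
theorem measureReal_mean_add_lt_average_le_of_indepFun {T : Type*} [Fintype T] [MeasurableSpace T]
    [MeasurableSingletonClass T] {Z : Ω → T} (hZ : Measurable Z)
    (hYmeas : ∀ k, Measurable (Y k))
    (hYlaw : ∀ k, μ.map (Y k) = q.toMeasure) (hYindep : iIndepFun Y μ)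
    (hZY : IndepFun Z (fun ω k => Y k ω) μ)
    (hlt : lo < hi) (hε : 0 ≤ ε) {f : T → S → ℝ} (hlo : ∀ z s, lo ≤ f z s)
    (hhi : ∀ z s, f z s ≤ hi) :
    μ.real {ω | q.mean (f (Z ω)) + ε < (∑ k, f (Z ω) (Y k ω)) / n} ≤
      Real.exp (-(2 * n * ε ^ 2 / (hi - lo) ^ 2)) := by
  set b := Real.exp (-(2 * n * ε ^ 2 / (hi - lo) ^ 2))
  let B (z : T) : Set (Fin n → S) := {y | q.mean (f z) + ε < (∑ k, f z (y k)) / n}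
  have hB (z : T) : MeasurableSet (B z) := by
    refine measurableSet_lt measurable_const (Measurable.div_const ?_ _)
    exact Finset.measurable_sum _ fun k _ =>
      (Measurable.of_discrete (f := f z)).comp (measurable_pi_apply k)
  -- Splitting by the value of `Z` costs no union bound: by independence the fixed-function bounds
  -- are averaged with weights summing to one.
  have hsub : {ω | q.mean (f (Z ω)) + ε < (∑ k, f (Z ω) (Y k ω)) / n} ⊆
      ⋃ z, Z ⁻¹' {z} ∩ (fun ω k => Y k ω) ⁻¹' B z := fun ω hω =>
    Set.mem_iUnion.2 ⟨Z ω, rfl, hω⟩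
  have hone : ∑ z, μ.real (Z ⁻¹' {z}) = 1 := by
    rw [sum_measureReal_preimage_singleton Finset.univ fun z _ => hZ (measurableSet_singleton z)]
    simp
  calc _ ≤ μ.real (⋃ z, Z ⁻¹' {z} ∩ (fun ω k => Y k ω) ⁻¹' B z) := measureReal_mono hsub
    _ ≤ ∑ z, μ.real (Z ⁻¹' {z} ∩ (fun ω k => Y k ω) ⁻¹' B z) := measureReal_iUnion_fintype_le _
    _ ≤ ∑ z, μ.real (Z ⁻¹' {z}) * b := by
        refine Finset.sum_le_sum fun z _ => ?_
        rw [measureReal_def, hZY.measure_inter_preimage_eq_mul _ _ (measurableSet_singleton z)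
          (hB z), ENNReal.toReal_mul]
        exact mul_le_mul_of_nonneg_left (measureReal_mean_add_lt_average_le hYmeas hYlaw hYindep
          hlt hε (hlo z) (hhi z)) measureReal_nonneg
    _ = b := by rw [← Finset.sum_mul, hone, one_mul]

end Concentration

/-! ### Deviation bounds for the empirical model. -/

namespace MDP

variable {S A : Type*} [Fintype S] [DecidableEq S]

theorem mean_empiricalPMF {n : ℕ} [NeZero n] (x : Fin n → S) (f : S → ℝ) :
    (empiricalPMF x).mean f = (∑ k, f (x k)) / n := by
  have h (s : S) : ((empiricalPMF x) s).toReal = (count x s : ℝ) / n := by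
    simp [empiricalPMF]
  simp only [PMF.mean, h, div_mul_eq_mul_div, ← Finset.sum_div]
  congr 1
  rw [← Finset.sum_fiberwise' Finset.univ x f]
  exact Finset.sum_congr rfl fun s _ => by simp [count]

/-- The sample table with the samples at state `s` erased. -/
def eraseSamples {n : ℕ} (s : S) (x : S × A × Fin n → S) (i : S × A × Fin n) : S :=
  -- The filler `s` is arbitrary.
  if i.1 = s then s else x i

section Sampling

variable [Fintype A] [MeasurableSpace S] {n : ℕ} {Ω : Type*} [MeasurableSpace Ω] {μ : Measure Ω}
  {X : S × A × Fin n → Ω → S}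

/-- The two sides are functions of disjoint blocks of samples: those at states other than `s`, and
those at `s`. -/
theorem indepFun_eraseSamples (hXmeas : ∀ i, Measurable (X i)) (hXindep : iIndepFun X μ)
    (s : S) (a : A) :
    IndepFun (fun ω => eraseSamples s fun i => X i ω) (fun ω k => X (s, a, k) ω) μ := by
  classical
  let T : Finset (S × A × Fin n) := Finset.univ.filter fun i => i.1 ≠ s
  let U : Finset (S × A × Fin n) := Finset.univ.filter fun i => i.1 = s
  have hTU : Disjoint T U := Finset.disjoint_left.2 fun i hT hU =>
    (Finset.mem_filter.1 hT).2 (Finset.mem_filter.1 hU).2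
  have h := hXindep.indepFun_finset T U hTU hXmeas
  let φ (y : T → S) (i : S × A × Fin n) : S :=
    if hi : i.1 = s then s else y ⟨i, Finset.mem_filter.2 ⟨Finset.mem_univ i, hi⟩⟩
  let ψ (y : U → S) (k : Fin n) : S :=
    y ⟨(s, a, k), Finset.mem_filter.2 ⟨Finset.mem_univ _, rfl⟩⟩
  have hφ : Measurable φ := measurable_pi_lambda _ fun i => by
    by_cases hi : i.1 = s
    · simp only [φ, hi, dite_true]; exact measurable_const
    · simp only [φ, hi, dite_false]; exact measurable_pi_apply _
  have hψ : Measurable ψ := measurable_pi_lambda _ fun k => measurable_pi_apply _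
  exact h.comp hφ hψ

variable [Nonempty A] [DiscreteMeasurableSpace S] [NeZero n] (M : MDP S A) [IsProbabilityMeasure μ] {lo hi ε : ℝ}

/-- It is unlikely that some sampled transition law underestimates the optimal value of `M`. -/
theorem measureReal_mean_empirical_add_lt_le (hXmeas : ∀ i, Measurable (X i))
    (hXlaw : ∀ s a k, μ.map (X (s, a, k)) = (M.P s a).toMeasure) (hXindep : iIndepFun X μ)
    (hlt : lo < hi) (hlo : ∀ s a, lo ≤ M.r s a) (hhi : ∀ s a, M.r s a ≤ hi) (hε : 0 ≤ ε)
    (s : S) (a : A) :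
    μ.real {ω | ((M.empirical fun i => X i ω).P s a).mean M.optimalValue + ε <
        (M.P s a).mean M.optimalValue} ≤ Real.exp (-(2 * n * ε ^ 2 / (hi - lo) ^ 2)) := by
  have hind : iIndepFun (fun k : Fin n => X (s, a, k)) μ :=
    hXindep.precomp (g := fun k : Fin n => (s, a, k)) fun k l h => by simpa using h
  -- An underestimate of the optimal value is an upper deviation of its negative.
  have key := measureReal_mean_add_lt_average_le (fun k => hXmeas (s, a, k)) (hXlaw s a) hind
    (neg_lt_neg hlt) hε (f := fun t => (-1) * M.optimalValue t)
    (fun t => by linarith [M.optimalValue_le hhi t]) (fun t => by linarith [M.le_optimalValue hlo t])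
  rw [show (-lo - -hi) = hi - lo by ring] at key
  refine (measureReal_mono fun ω hω => ?_).trans key
  simp only [Set.mem_ofPred_eq, empirical, mean_empiricalPMF] at hω
  simp only [Set.mem_ofPred_eq, PMF.mean_const_mul, ← Finset.mul_sum]
  rw [mul_div_assoc]
  linarith

/-- It is unlikely that some sampled transition law overestimates the optimal value of the empirical
model at an action that is optimal there. -/
theorem measureReal_lookahead_eq_and_lt_mean_empirical_le (hXmeas : ∀ i, Measurable (X i))
    (hXlaw : ∀ s a k, μ.map (X (s, a, k)) = (M.P s a).toMeasure) (hXindep : iIndepFun X μ)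
    (hlt : lo < hi) (hlo : ∀ s a, lo ≤ M.r s a) (hhi : ∀ s a, M.r s a ≤ hi) (hε : 0 ≤ ε)
    (s : S) (a : A) :
    μ.real {ω |
        (M.empirical fun i => X i ω).lookahead (M.empirical fun i => X i ω).optimalValue s a =
          (M.empirical fun i => X i ω).optimalValue s ∧
        (M.P s a).mean (M.empirical fun i => X i ω).optimalValue + ε <
          ((M.empirical fun i => X i ω).P s a).mean (M.empirical fun i => X i ω).optimalValue} ≤
      Real.exp (-(2 * n * ε ^ 2 / (hi - lo) ^ 2)) := by
  classical
  have hind : iIndepFun (fun k : Fin n => X (s, a, k)) μ :=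
    hXindep.precomp (g := fun k : Fin n => (s, a, k)) fun k l h => by simpa using h
  -- Truncation at `hi` supplies the uniform upper bound for Hoeffding. On the bad event it is
  -- inactive, the pinned value being below the empirical optimal value.
  let f (z : S × A × Fin n → S) (t : S) : ℝ :=
    min ((M.empirical z).pinnedValue s a (M.P s a) ε t) hi
  have hZ : Measurable fun ω => eraseSamples s fun i => X i ω := measurable_pi_lambda _ fun i => by
    by_cases hi : i.1 = s
    · simp only [eraseSamples, hi, if_true]; exact measurable_const
    · simp only [eraseSamples, hi, if_false]; exact hXmeas i
  refine (measureReal_mono fun ω hω => ?_).trans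
    (measureReal_mean_add_lt_average_le_of_indepFun hZ (fun k => hXmeas (s, a, k)) (hXlaw s a) hind
      (indepFun_eraseSamples hXmeas hXindep s a) hlt hε (f := f)
      (fun z t => le_min ((M.empirical z).le_pinnedValue s a _ ε hlo hε t) hlt.le)
      (fun z t => min_le_right _ _))
  obtain ⟨h1, h2⟩ := pinnedValue_le_and_lt_mean _ hω.1 hω.2
  have h3 : f (eraseSamples s fun i => X i ω) =
      (M.empirical fun i => X i ω).pinnedValue s a (M.P s a) ε := by
    funext t
    have h4 : (M.empirical (eraseSamples s fun i => X i ω)).pinnedValue s a (M.P s a) ε =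
        (M.empirical fun i => X i ω).pinnedValue s a (M.P s a) ε :=
      pinnedValue_congr _ s a _ ε rfl rfl fun t ht => by simp [empirical, eraseSamples, ht]
    simp only [f, h4]
    exact min_eq_left ((h1 t).trans (optimalValue_le (M.empirical fun i => X i ω) hhi t))
  simp only [Set.mem_ofPred_eq, h3]
  rwa [← mean_empiricalPMF fun k => X (s, a, k) ω]

end Sampling

end MDP

/-! ### Choice of constants and union bound. -/

theorem Real.exp_neg_le_div_of_log_le {c p x : ℝ} (hc : 0 < c) (hp : 0 < p)
    (h : Real.log (c / p) ≤ x) : Real.exp (-x) ≤ p / c := by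
  rw [← Real.exp_log (div_pos hp hc), Real.exp_le_exp, ← inv_div, Real.log_inv]
  linarith

theorem theorem4
    {S A : Type*}
    [Fintype S] [Nonempty S] [DecidableEq S] [MeasurableSpace S] [DiscreteMeasurableSpace S]
    [Fintype A] [Nonempty A] [MeasurableSpace A] [DiscreteMeasurableSpace A]
    (M : MDP S A) (α p : ℝ) (hα : 0 < α) (hp : 0 < p)
    (n : ℕ) [NeZero n]
    (hn : ⌈(M.γ / (1 - M.γ) * spanSeminorm (fun x : S × A => M.r x.1 x.2)) ^ 2
        * (2 * Real.log (2 * (Fintype.card S : ℝ) * (Fintype.card A : ℝ) / p) / α ^ 2)⌉ ≤ (n : ℤ))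
    {Ω : Type*} [MeasurableSpace Ω] (μ : Measure Ω) [IsProbabilityMeasure μ]
    -- `X (s, a, k)` is the `k`-th sample that the generative model returns on input `(s, a)`
    (X : S × A × Fin n → Ω → S)
    (hXmeas : ∀ i, Measurable (X i))
    (hXlaw : ∀ s a k, μ.map (X (s, a, k)) = (M.P s a).toMeasure)
    (hXindep : iIndepFun X μ) :
    1 - p ≤ μ.real {ω |
      (∃ π : MDP.Strategy S A, (M.empirical fun i => X i ω).IsOptimal π) ∧
      ∀ π : MDP.Strategy S A,
        (M.empirical fun i => X i ω).IsOptimal π → M.IsApproxOptimal α π} := by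
  set r : S × A → ℝ := fun x => M.r x.1 x.2 with hr
  set lo := ⨅ x, r x
  set hi := ⨆ x, r x
  have hlo (s : S) (a : A) : lo ≤ M.r s a := ciInf_le (Set.finite_range r).bddBelow (s, a)
  have hhi (s : S) (a : A) : M.r s a ≤ hi := le_ciSup (Set.finite_range r).bddAbove (s, a)
  set G := {ω | (∃ π : MDP.Strategy S A, (M.empirical fun i => X i ω).IsOptimal π) ∧
      ∀ π : MDP.Strategy S A,
        (M.empirical fun i => X i ω).IsOptimal π → M.IsApproxOptimal α π} with hG
  -- Hoeffding needs a nondegenerate range; for constant rewards every strategy is optimal.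
  rcases le_or_gt hi lo with hle | hlt
  · have hconst (s : S) (a : A) : M.r s a = lo := ((hhi s a).trans hle).antisymm (hlo s a)
    have : G = Set.univ := Set.eq_univ_of_forall fun ω =>
      ⟨MDP.exists_isOptimal _, fun π _ => MDP.isApproxOptimal_of_reward_eq hα.le hconst π⟩
    rw [this, probReal_univ]
    linarith
  have hγ := M.γ_pos
  have hγ1 : 0 < 1 - M.γ := sub_pos.2 M.γ_lt_one
  have hD : 0 < hi - lo := sub_pos.2 hlt
  -- Solves `2γε/(1-γ) = α`.
  set ε := α * (1 - M.γ) / (2 * M.γ) with hε_def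
  have hε : 0 ≤ ε := by positivity
  have hαε : 2 * (M.γ * ε / (1 - M.γ)) = α := by rw [hε_def]; field_simp
  let B₁ (x : S × A) : Set Ω :=
    {ω | ((M.empirical fun i => X i ω).P x.1 x.2).mean M.optimalValue + ε <
        (M.P x.1 x.2).mean M.optimalValue}
  let B₂ (x : S × A) : Set Ω :=
    {ω | (M.empirical fun i => X i ω).lookahead (M.empirical fun i => X i ω).optimalValue x.1 x.2 =
          (M.empirical fun i => X i ω).optimalValue x.1 ∧
        (M.P x.1 x.2).mean (M.empirical fun i => X i ω).optimalValue + ε <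
          ((M.empirical fun i => X i ω).P x.1 x.2).mean (M.empirical fun i => X i ω).optimalValue}
  -- A cover with subadditivity, instead of a complement, avoids proving `G` measurable.
  have hcover : Set.univ ⊆ G ∪ ⋃ x, (B₁ x ∪ B₂ x) := fun ω _ => by
    by_cases hω : ω ∈ ⋃ x, (B₁ x ∪ B₂ x)
    · exact Or.inr hω
    · simp only [Set.mem_iUnion, not_exists, Set.mem_union, not_or] at hω
      have h1 (s : S) (a : A) : (M.P s a).mean M.optimalValue ≤
          ((M.empirical fun i => X i ω).P s a).mean M.optimalValue + ε :=
        le_of_not_gt fun h => (hω (s, a)).1 h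
      have h2 (s : S) (a : A) (hsa : (M.empirical fun i => X i ω).lookahead
            (M.empirical fun i => X i ω).optimalValue s a =
          (M.empirical fun i => X i ω).optimalValue s) :
          ((M.empirical fun i => X i ω).P s a).mean (M.empirical fun i => X i ω).optimalValue ≤
            (M.P s a).mean (M.empirical fun i => X i ω).optimalValue + ε :=
        le_of_not_gt fun h => (hω (s, a)).2 ⟨hsa, h⟩
      refine Or.inl ⟨MDP.exists_isOptimal _, fun π hπ => ?_⟩
      have h3 := MDP.IsOptimal.isApproxOptimal_of_mean_le (M := M)
        (N := M.empirical fun i => X i ω) rfl rfl hε h1 h2 hπ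
      rwa [hαε] at h3
  have hcard : (0 : ℝ) < 2 * Fintype.card S * Fintype.card A := by
    have := Fintype.card_pos (α := S)
    have := Fintype.card_pos (α := A)
    positivity
  set b := Real.exp (-(2 * n * ε ^ 2 / (hi - lo) ^ 2)) with hb_def
  have hb : b ≤ p / (2 * Fintype.card S * Fintype.card A) := by
    refine Real.exp_neg_le_div_of_log_le hcard hp ?_
    set L := Real.log (2 * (Fintype.card S : ℝ) * (Fintype.card A : ℝ) / p)
    have h1 : (M.γ / (1 - M.γ) * (hi - lo)) ^ 2 * (2 * L / α ^ 2) ≤ n := by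
      exact_mod_cast Int.ceil_le.1 hn
    -- At the threshold sample size the Hoeffding exponent is exactly `L`.
    have h2 : L = 2 * ((M.γ / (1 - M.γ) * (hi - lo)) ^ 2 * (2 * L / α ^ 2)) * ε ^ 2 /
        (hi - lo) ^ 2 := by
      rw [hε_def]; field_simp
    rw [h2]
    gcongr
  have hbad : μ.real (⋃ x, (B₁ x ∪ B₂ x)) ≤ p := by
    calc _ ≤ ∑ x, μ.real (B₁ x ∪ B₂ x) := measureReal_iUnion_fintype_le _
      _ ≤ ∑ _x : S × A, 2 * b := Finset.sum_le_sum fun x _ => by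
          have h1 := M.measureReal_mean_empirical_add_lt_le hXmeas hXlaw hXindep hlt hlo hhi hε
            x.1 x.2
          have h2 := M.measureReal_lookahead_eq_and_lt_mean_empirical_le hXmeas hXlaw hXindep hlt
            hlo hhi hε x.1 x.2
          exact (measureReal_union_le _ _).trans ((add_le_add h1 h2).trans_eq (two_mul b).symm)
      _ = 2 * Fintype.card S * Fintype.card A * b := by
          simp only [Finset.sum_const, Finset.card_univ, Fintype.card_prod, nsmul_eq_mul]
          push_cast
          ring
      _ ≤ 2 * Fintype.card S * Fintype.card A * (p / (2 * Fintype.card S * Fintype.card A)) :=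
          mul_le_mul_of_nonneg_left hb hcard.le
      _ = p := mul_div_cancel₀ p hcard.ne'
  have h1 := (measureReal_mono hcover (μ := μ)).trans (measureReal_union_le _ _)
  rw [probReal_univ] at h1
  linarith
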